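/- **Setting.** A program $P$ gives, for each predicate, finitely many rules $H \leftarrow B_1,\dots,B_n$ ($n\ge 1$) in normal form: heads and body atoms have distinct variables as arguments, and a literal is an atom or a primitive constraint. An abstract domain $D_\alpha$ provides, for each finite set of variables, a join semilattice with least element $\bot$ of descriptions (join: $\mathsf{Alub}$) and monotone operations $\mathsf{Arestrict},\mathsf{Aextend},\mathsf{Aadd},\mathsf{Aconj}$. A call pattern is a pair $A{:}CP$ of an atom and a description of its variables, taken up to renaming. A table (answer table, certificate or policy) is a set of entries $A{:}CP\mapsto AP$ with at most one entry for each call pattern; $X\sqsubseteq I$ means that each entry $A{:}CP\mapsto AP$ of $X$ has a counterpart $A{:}CP\mapsto AP'$ in $I$ with $AP\sqsubseteq AP'$. **Fixpoints.** Given a table $X$, a rule is executed on a call $A{:}CP$ as follows. Start with $d=\mathsf{Aextend}(CP)$ to the variables of the rule. Treat the literals from left to right: a constraint $c$ replaces $d$ by $\mathsf{Aadd}(c,d)$; an atom $B$ generates the call $B{:}\mathsf{Arestrict}(d,\mathrm{vars}(B))$ and replaces $d$ by $\mathsf{Aconj}(d,\mathsf{Aextend}(AP))$, where $AP$ is the answer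 of $X$ to this call ($\bot$ if there is none). Stop with answer $\bot$ when $d=\bot$; otherwise the answer is the final $d$ restricted to $\mathrm{vars}(H)$. Let $\mathrm{Ans}_{P,X}(A{:}CP)$ be the least upper bound of the answers of all the rules of the predicate of $A$. A round of the analysis for a finite set $S_\alpha$ of initial call patterns maps $X$ to the table that has an entry $A{:}CP\mapsto \mathsf{Alub}(X(A{:}CP),\mathrm{Ans}_{P,X}(A{:}CP))$ exactly for the $A{:}CP$ that are in $S_\alpha$, have an entry in $X$, or are generated as a call by executing a rule, with $X$, on a call that has an entry in $X$ (again, $X(A{:}CP)=\bot$ if there is no entry). $X$ is a *fixpoint* of $P$ (for $S_\alpha$) if a round leaves $X$ unchanged, that is: $X$ has entries for $S_\alpha$ and for all calls generated from its entries, and $\mathrm{Ans}_{P,X}(A{:}CP)\sqsubseteq AP$ for each entry $A{:}CP\mapsto AP$ of $X$. **Checker.** $\textsf{Checking\_r}(S_\alpha,\Omega,\mathsf{RCert})$ keeps an answer table $AT$, a dependency arc table $DAT$ (both initially empty) and a queue of events, initially $\mathit{newcall}(a)$ for $a\in S_\alpha$. As long as the queue is nonempty, the queue handling strategy $\Omega$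 selects an event, which is removed and processed: * $\mathit{newcall}(A{:}CP)$: for every rule of $A$, the arc of its first literal, with counter $u=0$ and annotation $\mathsf{Aextend}(CP)$, is put into the queue; $A{:}CP\mapsto\bot$ is put into $AT$. * $\mathit{updated}(A{:}CP)$: all arcs in $DAT$ that depend on (i.e. whose literal is called with) $A{:}CP$ are put into the queue. * an arc $H(u){:}CP_0\Rightarrow[CP_1]\,B{:}CP_2$, where $CP_2=\mathsf{Arestrict}(CP_1,\mathrm{vars}(B))$: let $CP_3$ be the description after $B$, using the answer in $AT$ for $B{:}CP_2$ (if there is no entry, the answer is $\bot$ and $\mathit{newcall}(B{:}CP_2)$ is put into the queue). If $B$ is an atom, then: if $CP_3=\bot$ (the arc is suspended), the arc is put into $DAT$ unchanged; if $CP_3\ne\bot$ and $u+1>1$, an error is issued; otherwise the arc is put into $DAT$ with counter $u+1$. An arc put into $DAT$ replaces the arcs for the same rule, call $H{:}CP_0$ and literal in $DAT$ and in the queue. If $CP_3\neq\bot$, then the arc of the next literal of the rule, with annotation $CP_3$ and counter $0$, is put into the queue, or, if $B$ is the last literal, the entry $H{:}CP_0\mapsto AP$ with $AP=\mathsf{Arestrict}(CP_3,\mathrm{vars}(H))$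 is inserted. * inserting $H{:}CP\mapsto AP$: let $AP_0$ be the answer in $AT$ and $AP_1=\mathsf{Alub}(AP,AP_0)$. If $\mathsf{RCert}$ has an entry $H{:}CP\mapsto AP'$ and $\mathsf{Alub}(AP,AP')\ne AP'$, an error is issued. Otherwise, if $AP_0\neq AP_1$, the answer in $AT$ becomes $AP'$ if $AP_0=\bot$ and such an entry of $\mathsf{RCert}$ exists, and $AP_1$ otherwise; and $\mathit{updated}(H{:}CP)$ is put into the queue if some arc in $DAT$ depends on $H{:}CP$. When the queue is empty, the result is $AT$; if this never happens, the outcome is an error. $\textsf{Checker\_r}(P,D_\alpha,S_\alpha,I_\alpha,\Omega,\mathsf{RCert})$ issues an error if $\textsf{Checking\_r}$ does; otherwise it returns the table $\mathsf{FCert}$ computed by $\textsf{Checking\_r}$ if and only if $\mathsf{FCert}\sqsubseteq I_\alpha$. **Theorem (correctness).** Let $P$ be a program, $D_\alpha$ an abstract domain, $S_\alpha$ a finite set of call patterns, $I_\alpha$ a safety policy, $\Omega$ any queue handling strategy and $\mathsf{RCert}$ any certificate. If $\textsf{Checker\_r}(P,D_\alpha,S_\alpha,I_\alpha,\Omega,\mathsf{RCert})$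 issues no error and returns $\mathsf{FCert}$, then 1. $\mathsf{FCert}$ is a fixpoint of $P$ for $S_\alpha$; moreover, each of its entries $A{:}CP\mapsto AP$ satisfies the exact equation $AP=\mathrm{Ans}_{P,\mathsf{FCert}}(A{:}CP)$ unless it is itself an entry of $\mathsf{RCert}$; 2. $\mathsf{FCert}\sqsubseteq I_\alpha$. -/

import Mathlib

universe u v w

namespace ACC

noncomputable section

/-! ### Programs -/

/-- The syntax of a constraint logic language: predicate symbols with arities, and the primitive
constraints on `n` variables (the variables are numbered `0, …, n - 1`). -/
structure Signature where
  Pred : Type u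
  arity : Pred → ℕ
  Con : ℕ → Type v

/-- A body literal of a rule with `n` variables: a primitive constraint, or a normalized atom
`p(x₁, …, xₘ)` whose arguments are distinct variables. -/
inductive Literal (Sg : Signature.{u, v}) (n : ℕ) : Type (max u v)
  | constraint (c : Sg.Con n) : Literal Sg n
  | atom (p : Sg.Pred) (args : Fin (Sg.arity p) ↪ Fin n) : Literal Sg n

/-- A rule `H :- B₁, …, Bₙ` with `n ≥ 1` for the predicate `p`: the head is `p` applied to distinct
variables (a fact is written with a trivially true constraint as its body). -/
structure Rule (Sg : Signature.{u, v}) (p : Sg.Pred) where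
  nvars : ℕ
  head : Fin (Sg.arity p) ↪ Fin nvars
  body : List (Literal Sg nvars)
  body_ne_nil : body ≠ []

/-- A program lists, for every predicate, the finitely many rules that define it. -/
abbrev Program (Sg : Signature.{u, v}) : Type (max u v) :=
  (p : Sg.Pred) → List (Rule Sg p)

/-! ### Abstract domains, call patterns, answer tables -/

/-- An abstract domain: for every `n` a join semilattice with least element of descriptions of `n`
variables (`⊔` is `Alub`), with the monotone abstract operations of the analysis.
For an injection `f`, `restrict f` is `Arestrict` to the variables in the range of `f`, and
`extend f` is `Aextend` of a description of these variables to all the variables; both are composed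
with the renaming given by `f`. -/
structure AbsDomain (Sg : Signature.{u, v}) where
  Desc : ℕ → Type w
  [semilatticeSup : ∀ n, SemilatticeSup (Desc n)]
  [orderBot : ∀ n, OrderBot (Desc n)]
  restrict : ∀ {m n : ℕ}, (Fin m ↪ Fin n) → Desc n → Desc m
  extend : ∀ {m n : ℕ}, (Fin m ↪ Fin n) → Desc m → Desc n
  add : ∀ {n : ℕ}, Sg.Con n → Desc n → Desc n
  conj : ∀ {n : ℕ}, Desc n → Desc n → Desc n
  restrict_mono : ∀ {m n : ℕ} (f : Fin m ↪ Fin n), Monotone (restrict f)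
  extend_mono : ∀ {m n : ℕ} (f : Fin m ↪ Fin n), Monotone (extend f)
  add_mono : ∀ {n : ℕ} (c : Sg.Con n), Monotone (add c)
  conj_mono : ∀ {n : ℕ} {a a' b b' : Desc n}, a ≤ a' → b ≤ b' → conj a b ≤ conj a' b'

attribute [instance] AbsDomain.semilatticeSup AbsDomain.orderBot

variable {Sg : Signature.{u, v}}

/-- An abstract atom (call pattern) `A : CP`. The atom `A` is in base form, that is, its arguments
are the variables `0, …, arity - 1`; so equality of abstract atoms is variance of call patterns. -/
structure AAtom (D : AbsDomain.{u, v, w} Sg) where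
  pred : Sg.Pred
  cp : D.Desc (Sg.arity pred)

/-- The descriptions of the arguments of an abstract atom. -/
abbrev AAtom.Ans {D : AbsDomain.{u, v, w} Sg} (a : AAtom D) : Type w :=
  D.Desc (Sg.arity a.pred)

/-- A table of entries `A : CP ↦ AP`, with at most one entry for every abstract atom. Answer tables,
certificates and safety policies are such tables. -/
abbrev Table (D : AbsDomain.{u, v, w} Sg) : Type (max u w) :=
  (a : AAtom D) → Option a.Ans

/-- The answer that a table gives for a call pattern, `⊥` if there is no entry. -/
def Table.answer {D : AbsDomain.{u, v, w} Sg} (X : Table D) (a : AAtom D) : a.Ans :=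
  (X a).getD ⊥

/-- The order `X ⊑ I` on tables: every entry `A : CP ↦ AP` of `X` has a counterpart
`A : CP ↦ AP'` in `I` with `AP ⊑ AP'`. For a policy `I`: the call pattern is permitted, and its
answers satisfy the bound that the policy gives. -/
def Table.Below {D : AbsDomain.{u, v, w} Sg} (X I : Table D) : Prop :=
  ∀ (a : AAtom D) (ap : a.Ans), X a = some ap → ∃ ap' : a.Ans, I a = some ap' ∧ ap ≤ ap'

/-! ### The abstract semantics of a program -/

/-- The call pattern (in base form) of a literal that is reached with description `d`. -/
def Literal.call (D : AbsDomain.{u, v, w} Sg) {n : ℕ} (l : Literal Sg n) (d : D.Desc n) :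
    Option (AAtom D) :=
  match l with
  | .constraint _ => none
  | .atom p f => some ⟨p, D.restrict f d⟩

/-- The description after a literal, if atoms are answered as given by `T`. -/
def Literal.exec {D : AbsDomain.{u, v, w} Sg} (T : (a : AAtom D) → a.Ans) {n : ℕ}
    (l : Literal Sg n) (d : D.Desc n) : D.Desc n :=
  match l with
  | .constraint c => D.add c d
  | .atom p f => D.conj d (D.extend f (T ⟨p, D.restrict f d⟩))

open Classical in
/-- The description after a body is executed from left to right; `⊥` stops the execution. -/
def execBody {D : AbsDomain.{u, v, w} Sg} (T : (a : AAtom D) → a.Ans) {n : ℕ} :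
    List (Literal Sg n) → D.Desc n → D.Desc n
  | [], d => d
  | l :: ls, d => if l.exec T d = ⊥ then ⊥ else execBody T ls (l.exec T d)

/-- The call patterns that this execution of a body generates. -/
def bodyCalls {D : AbsDomain.{u, v, w} Sg} (T : (a : AAtom D) → a.Ans) {n : ℕ} :
    List (Literal Sg n) → D.Desc n → Set (AAtom D)
  | [], _ => ∅
  | l :: ls, d =>
    {a | l.call D d = some a ∨ (l.exec T d ≠ ⊥ ∧ a ∈ bodyCalls T ls (l.exec T d))}

open Classical in
/-- The abstract answer of a rule to the call pattern `cp`. -/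
def Rule.ans {D : AbsDomain.{u, v, w} Sg} (T : (a : AAtom D) → a.Ans) {p : Sg.Pred}
    (r : Rule Sg p) (cp : D.Desc (Sg.arity p)) : D.Desc (Sg.arity p) :=
  if execBody T r.body (D.extend r.head cp) = ⊥ then ⊥
  else D.restrict r.head (execBody T r.body (D.extend r.head cp))

/-- The abstract answer of the program to a call pattern: the least upper bound of the answers of
the rules of its predicate, where the atoms in their bodies are answered by `T`. -/
def progAns (P : Program Sg) {D : AbsDomain.{u, v, w} Sg} (T : (a : AAtom D) → a.Ans)
    (a : AAtom D) : a.Ans :=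
  Finset.univ.sup fun k : Fin (P a.pred).length => ((P a.pred).get k).ans T a.cp

/-- The call patterns that the rules for `a` generate when atoms are answered by `T`. -/
def progCalls (P : Program Sg) {D : AbsDomain.{u, v, w} Sg} (T : (a : AAtom D) → a.Ans)
    (a : AAtom D) : Set (AAtom D) :=
  {b | ∃ k : Fin (P a.pred).length,
    b ∈ bodyCalls T ((P a.pred).get k).body (D.extend ((P a.pred).get k).head a.cp)}

open Classical in
/-- One round of the analysis of `P` for the initial call patterns `S`: the new table has an entry
for the initial calls, for the calls in the old table and for the calls these generate; its answers
are the least upper bounds (`Alub`) of the old answers with those that the rules now produce. -/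
def analysisOp (P : Program Sg) {D : AbsDomain.{u, v, w} Sg} (S : Finset (AAtom D))
    (X : Table D) : Table D := fun a =>
  if a ∈ S ∨ (X a).isSome ∨ ∃ b : AAtom D, (X b).isSome ∧ a ∈ progCalls P X.answer b then
    some (X.answer a ⊔ progAns P X.answer a)
  else none

/-- A table is a fixpoint of `P` for `S` if a round of the analysis does not change it. -/
def IsFixpoint (P : Program Sg) {D : AbsDomain.{u, v, w} Sg} (S : Finset (AAtom D))
    (X : Table D) : Prop :=
  analysisOp P S X = X

/-! ### Queue handling strategies -/

/-- A queue handling strategy: `select` returns the next event, one of the events in the nonempty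
queue `Q`, and may take into account the list of all the additions of events to the queue so far
(latest first). -/
structure QHS (E : Type*) where
  select : List E → (Q : Finset E) → Q.Nonempty → E
  select_mem : ∀ (added : List E) (Q : Finset E) (h : Q.Nonempty), select added Q h ∈ Q

/-! ### The checker -/

section Checker

variable (P : Program Sg) (D : AbsDomain.{u, v, w} Sg)

/-- The place of a dependency arc: the literal number `i` of the rule number `k` for the abstract
atom `call`, which is `H : CP₀`. -/
structure ArcPos where
  call : AAtom D
  k : Fin (P call.pred).length
  i : Fin ((P call.pred).get k).body.length

variable {P D}

/-- The rule of an arc. -/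
def ArcPos.rule (q : ArcPos P D) : Rule Sg q.call.pred :=
  (P q.call.pred).get q.k

/-- The literal of an arc. -/
def ArcPos.lit (q : ArcPos P D) : Literal Sg q.rule.nvars :=
  q.rule.body.get q.i

variable (P D)

/-- A dependency arc `H(u) : CP₀ ⇒ [CP₁] B : CP₂`. Here `ann` is `CP₁`, and `CP₂`, which is always
`Arestrict(CP₁, vars(B))`, is not stored. The counter `u` is the number of traversals of the arc in
which it was not suspended. -/
structure Arc where
  pos : ArcPos P D
  ann : D.Desc pos.rule.nvars
  u : ℕ

/-- The events in the prioritized event queue. -/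
inductive Event
  | newcall (a : AAtom D)
  | updated (a : AAtom D)
  | arc (R : Arc P D)

/-- The global data structures: answer table `AT`, dependency arc table `DAT`, event queue, and the
record of the additions to the queue, on which the strategy may depend. -/
structure State where
  table : Table D
  dat : List (Arc P D)
  queue : Finset (Event P D)
  added : List (Event P D)

variable {P D}

/-- The call pattern `B : CP₂` on which an arc depends (none if `B` is a constraint). -/
def Arc.callee (R : Arc P D) : Option (AAtom D) :=
  R.pos.lit.call D R.ann

open Classical in
/-- `add_event`. -/
def State.addEvent (s : State P D) (e : Event P D) : State P D :=
  { s with queue := insert e s.queue, added := e :: s.added }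

open Classical in
/-- `add_answer_table`. -/
def State.setAnswer (s : State P D) (a : AAtom D) (ap : a.Ans) : State P D :=
  { s with table := Function.update s.table a (some ap) }

open Classical in
/-- Adding an arc to `DAT`. It replaces every arc for the same rule, call pattern and literal in
`DAT` and in the event queue. -/
def State.addArc (s : State P D) (R : Arc P D) : State P D :=
  { s with
    dat := R :: s.dat.filter fun R' => R'.pos ≠ R.pos
    queue := s.queue.filter fun e => ∀ R', e = .arc R' → R'.pos ≠ R.pos }

/-- The arc with which the treatment of the rule number `k` for a new call pattern begins. -/
def firstArc (P : Program Sg) (a : AAtom D) (k : Fin (P a.pred).length) : Arc P D where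
  pos := ⟨a, k, ⟨0, List.length_pos_of_ne_nil ((P a.pred).get k).body_ne_nil⟩⟩
  ann := D.extend ((P a.pred).get k).head a.cp
  u := 0

/-- `new_call_pattern`. -/
def newCallPattern (a : AAtom D) (s : State P D) : State P D :=
  State.setAnswer
    ((List.finRange (P a.pred).length).foldl (fun t k => t.addEvent (.arc (firstArc P a k))) s) a ⊥

/-- `lookup_answer`; it generates a `newcall` event if there is no entry. -/
def lookupAnswer (a : AAtom D) (s : State P D) : a.Ans × State P D :=
  match s.table a with
  | some ap => (ap, s)
  | none => (⊥, s.addEvent (.newcall a))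

/-- `get_answer`. -/
def getAnswer {n : ℕ} (l : Literal Sg n) (d : D.Desc n) (s : State P D) : D.Desc n × State P D :=
  match l with
  | .constraint c => (D.add c d, s)
  | .atom p f =>
    let r := lookupAnswer (⟨p, D.restrict f d⟩ : AAtom D) s
    (D.conj d (D.extend f r.1), r.2)

open Classical in
/-- `add_dependent_rules`. -/
def addDependentRules (a : AAtom D) (s : State P D) : State P D :=
  (s.dat.filter fun R => R.callee = some a).foldl (fun t R => t.addEvent (.arc R)) s

open Classical in
/-- `insert_answer_info` of the checker with certificate `RCert`, for the entry `a ↦ ap`; the value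
`none` is the error that `ap` does not agree with the entry of the certificate. -/
def insertAnswerInfo (RCert : Table D) (a : AAtom D) (ap : a.Ans) (s : State P D) :
    Option (State P D) :=
  let r := lookupAnswer a s
  let ap₀ := r.1
  let ap₁ := ap ⊔ ap₀
  if ∃ ap' : a.Ans, RCert a = some ap' ∧ ap ⊔ ap' ≠ ap' then none
  else if ap₀ = ap₁ then some r.2
  else
    let new : a.Ans := if ap₀ = ⊥ then (RCert a).getD ap₁ else ap₁
    let t := r.2.setAnswer a new
    some (if ∃ R ∈ t.dat, R.callee = some a then t.addEvent (.updated a) else t)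

open Classical in
/-- `process_arc` of the checker. After a traversal of the arc of an atom, the arc goes to `DAT`,
with the same counter if the arc is suspended (the traversal gives `⊥`) and with counter `u + 1`
otherwise. The value `none` is an error: the arc would be multi-traversed, or one was issued by
`insert_answer_info`. -/
def processArc (RCert : Table D) (R : Arc P D) (s : State P D) : Option (State P D) :=
  let r := getAnswer R.pos.lit R.ann s
  let d := r.1
  let s₁ : Option (State P D) :=
    match R.pos.lit with
    | .constraint _ => some r.2
    | .atom _ _ =>
      if d = ⊥ then some (r.2.addArc R)
      else if 1 < R.u + 1 then none
      else some (r.2.addArc { R with u := R.u + 1 })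
  s₁.bind fun t =>
    if d = ⊥ then some t
    else if h : (R.pos.i : ℕ) + 1 < R.pos.rule.body.length then
      some (t.addEvent (.arc ⟨⟨R.pos.call, R.pos.k, ⟨R.pos.i + 1, h⟩⟩, d, 0⟩))
    else insertAnswerInfo RCert R.pos.call (D.restrict R.pos.rule.head d) t

open Classical in
/-- One pass through the main loop: the next event is removed from the queue and processed. The
state is final if the queue is empty; `none` is an error. -/
def step (Ω : QHS (Event P D)) (RCert : Table D) (s : State P D) : Option (State P D) :=
  if h : s.queue.Nonempty then
    let e := Ω.select s.added s.queue h
    let t : State P D := { s with queue := s.queue.erase e }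
    match e with
    | .newcall a => some (newCallPattern a t)
    | .updated a => some (addDependentRules a t)
    | .arc R => processArc RCert R t
  else some s

variable (P)

/-- The state before the main loop: empty tables, and a `newcall` event for every initial call. -/
def initState (S : Finset (AAtom D)) : State P D :=
  S.toList.foldl (fun t a => t.addEvent (.newcall a)) ⟨fun _ => none, [], ∅, []⟩

/-- The state after `n` passes through the main loop, `none` after an error. -/
def run (S : Finset (AAtom D)) (Ω : QHS (Event P D)) (RCert : Table D) : ℕ → Option (State P D)
  | 0 => some (initState P S)
  | n + 1 => (run S Ω RCert n).bind (step Ω RCert)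

/-- `s` is the state in which the main loop terminates without an error. -/
def Terminates (S : Finset (AAtom D)) (Ω : QHS (Event P D)) (RCert : Table D) (s : State P D) :
    Prop :=
  ∃ n : ℕ, run P S Ω RCert n = some s ∧ s.queue = ∅

open Classical in
/-- `Checking_r`: the final answer table, or `none` (error) if an error is issued or if no answer
table is produced. -/
def checking (S : Finset (AAtom D)) (Ω : QHS (Event P D)) (RCert : Table D) : Option (Table D) :=
  if h : ∃ s, Terminates P S Ω RCert s then some h.choose.table else none

variable (D)

open Classical in
/-- `Checker_r`: it returns the table `FCert` that `Checking_r` returns if `FCert ⊑ I`; otherwise it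
returns no certificate. -/
def checker (S : Finset (AAtom D)) (I : Table D) (Ω : QHS (Event P D)) (RCert : Table D) :
    Option (Table D) :=
  match checking P S Ω RCert with
  | none => none
  | some FCert => if FCert.Below I then some FCert else none

end Checker

end

end ACC

/-!
The table is correct because every arc is traversed at most once without suspension, and that one
traversal used the final answers.

The annotations of the arcs that have been created form a *trace* of the execution of the rules: for
each call and rule the description with which every literal reached so far was reached. The checker
does not store it (arcs of constraints leave no record), so the invariant of the main loop
(`Invariant`) asserts the existence of a trace to which the state is `Tied`. The counter of an arc is
`0` exactly while the point after its literal is not in the trace. Whenever a literal is reached, its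
arc is in the queue, or it is `Settled`: the trace agrees with what the literal does under the current
table, or the event `updated` for its callee is in the queue.

Answers in the table only grow, so by monotonicity an arc that was once not suspended cannot be
suspended later; hence its second traversal is an error, and in a run without errors each point of the
trace is written once (`Tied.traverse`, `Invariant.processArc`). A change of an answer unsettles only
the literals that call it, and all of them are reported (`Tied.setAnswer`).

The answers in the table are `Explained` by the trace: each is an upper bound of the answers of the
rules that are complete, and equals their least upper bound unless it was taken from the certificate.
The latter is kept by an insertion because the inserted answer has passed the comparison with the
certificate: an entry taken from there never changes again (`Tied.insertAnswerInfo`).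

When the queue is empty, every reached literal agrees with the table, so the trace is the execution of
the rules with the final table (`Tied.execBody_drop`), and the fixpoint property can be read off.
-/

namespace ACC

section Correctness

variable {Sg : Signature.{u, v}} {P : Program Sg} {D : AbsDomain.{u, v, w} Sg}

/-! ### Dependence of the execution of a literal on the table -/

theorem Literal.exec_mono {T T' : (a : AAtom D) → a.Ans} (h : ∀ b, T b ≤ T' b) {n : ℕ}
    (l : Literal Sg n) (d : D.Desc n) : l.exec T d ≤ l.exec T' d := by
  cases l with
  | constraint c => exact le_rfl
  | atom p f => exact D.conj_mono le_rfl (D.extend_mono f (h _))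

theorem Literal.exec_congr {T T' : (a : AAtom D) → a.Ans} {n : ℕ} (l : Literal Sg n)
    (d : D.Desc n) (h : ∀ b, l.call D d = some b → T b = T' b) : l.exec T d = l.exec T' d := by
  cases l with
  | constraint c => rfl
  | atom p f => simp only [Literal.exec, h _ rfl]

/-! ### Traces -/

/-- A point in the execution of a rule for a call: before the literal number `i`, or after the last
literal if `i` is the length of the body. Larger values of `i` are never reached. -/
structure Slot (P : Program Sg) (D : AbsDomain.{u, v, w} Sg) where
  call : AAtom D
  k : Fin (P call.pred).length
  i : ℕ

abbrev Slot.rule (x : Slot P D) : Rule Sg x.call.pred :=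
  (P x.call.pred).get x.k

/-- The point after the next literal. -/
def Slot.next (x : Slot P D) : Slot P D := ⟨x.call, x.k, x.i + 1⟩

/-- The point before the literal of an arc. -/
def ArcPos.slot (q : ArcPos P D) : Slot P D := ⟨q.call, q.k, q.i⟩

theorem Slot.next_injective {x y : Slot P D} (h : x.next = y.next) : x = y := by
  obtain ⟨a, k, i⟩ := x
  obtain ⟨b, l, j⟩ := y
  simp only [Slot.next, Slot.mk.injEq] at h ⊢
  exact ⟨h.1, h.2.1, by omega⟩

theorem Slot.next_ne_self (x : Slot P D) : x.next ≠ x := fun h => by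
  have := congrArg Slot.i h
  simp [Slot.next] at this

theorem ArcPos.slot_injective {q r : ArcPos P D} (h : q.slot = r.slot) : q = r := by
  obtain ⟨a, k, i⟩ := q
  obtain ⟨b, l, j⟩ := r
  simp only [ArcPos.slot, Slot.mk.injEq] at h
  obtain ⟨rfl, h2, h3⟩ := h
  obtain rfl := eq_of_heq h2
  obtain rfl := Fin.ext h3
  rfl

/-- A trace records, for every point that the execution of a rule has reached, the description with
which it was reached. -/
abbrev Trace (P : Program Sg) (D : AbsDomain.{u, v, w} Sg) : Type (max u w) :=
  (x : Slot P D) → Option (D.Desc x.rule.nvars)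

/-- The recorded description before the literal of an arc. -/
def Trace.before (g : Trace P D) (q : ArcPos P D) : Option (D.Desc q.rule.nvars) := g q.slot

theorem Trace.before_eq_none {g : Trace P D} {q : ArcPos P D} {x : Slot P D} (h : q.slot = x)
    (hx : g x = none) : g.before q = none := by
  subst h
  exact hx

/-- The recorded description after the literal of an arc. -/
def Trace.after (g : Trace P D) (q : ArcPos P D) : Option (D.Desc q.rule.nvars) := g q.slot.next

/-- The answer that a completed execution of a rule has given, `⊥` if it is not complete. -/
def Trace.ruleAns (g : Trace P D) (a : AAtom D) (k : Fin (P a.pred).length) : a.Ans :=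
  (g ⟨a, k, ((P a.pred).get k).body.length⟩).elim ⊥ (D.restrict ((P a.pred).get k).head)

/-- The least upper bound of the answers of all the completed executions for a call. -/
def Trace.collected (g : Trace P D) (a : AAtom D) : a.Ans :=
  Finset.univ.sup fun k => g.ruleAns a k

/-! ### The invariant of the main loop -/

/-- The literal at `q`, reached with description `e`, needs no further traversal unless its callee is
reported as updated: its arc is in `DAT` and its callee is known (if it is an atom), and the trace
agrees with the current table. A point after the literal that is not reached stands for `⊥`. -/
def Settled (g : Trace P D) (s : State P D) (q : ArcPos P D) (e : D.Desc q.rule.nvars) : Prop :=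
  (∀ b, q.lit.call D e = some b →
    (∃ R ∈ s.dat, R.pos = q) ∧ ((s.table b).isSome ∨ Event.newcall b ∈ s.queue)) ∧
  (q.lit.exec s.table.answer e = (g.after q).getD ⊥ ∨
    ∃ b, q.lit.call D e = some b ∧ Event.updated b ∈ s.queue)

/-- The invariant that ties the data structures to a trace `g`. The positions in `E` are exempt from
the requirement that a reached literal is settled or has its arc in the queue; this is for the states
in the middle of the processing of an event. -/
structure Tied (g : Trace P D) (E : ArcPos P D → Prop) (s : State P D) : Prop where
  /-- Processing `newcall a` resets the answer for `a`, so this must happen only once. -/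
  newcall : ∀ a, Event.newcall a ∈ s.queue → s.table a = none
  start_some : ∀ a k, (s.table a).isSome →
    g ⟨a, k, 0⟩ = some (D.extend ((P a.pred).get k).head a.cp)
  start_none : ∀ a k, s.table a = none → g ⟨a, k, 0⟩ = none
  down : ∀ x, g x = none → g x.next = none
  /-- A traversal that was not suspended stays so: the table only grows. -/
  chain : ∀ q e d, g.before q = some e → g.after q = some d →
    d ≠ ⊥ ∧ d ≤ q.lit.exec s.table.answer e
  arcs : ∀ R, (Event.arc R ∈ s.queue ∨ R ∈ s.dat) →
    g.before R.pos = some R.ann ∧ (R.u = 0 ↔ g.after R.pos = none)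
  /-- Only arcs of atoms are in `DAT`, so the arc of a constraint never returns to the queue. -/
  dat_callee : ∀ R ∈ s.dat, R.callee.isSome
  queue_constraint : ∀ R, Event.arc R ∈ s.queue → R.callee = none → R.u = 0
  progress : ∀ q e, g.before q = some e →
    E q ∨ (∃ R, Event.arc R ∈ s.queue ∧ R.pos = q) ∨ Settled g s q e

/-- The answers in the table bound those collected by the trace, and differ from them only if they
are taken from the certificate. -/
def Explained (RCert : Table D) (g : Trace P D) (s : State P D) : Prop :=
  ∀ a ap, s.table a = some ap →
    g.collected a ≤ ap ∧ (g.collected a = ap ∨ RCert a = some ap)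

theorem Tied.isSome_of_reached {g : Trace P D} {E s} (h : Tied g E s) (x : Slot P D)
    (hx : g x ≠ none) : (s.table x.call).isSome := by
  obtain ⟨a, k, i⟩ := x
  induction i with
  | zero =>
    by_contra hn
    exact hx (h.start_none a k (by simpa using hn))
  | succ i ih => exact ih fun h0 => hx (h.down ⟨a, k, i⟩ h0)

theorem Tied.drop_exempt {g : Trace P D} {E s} (h : Tied g E s)
    (hE : ∀ q e, g.before q = some e → E q → False) : Tied g (fun _ => False) s :=
  { h with
    progress := fun q e he => Or.inr ((h.progress q e he).resolve_left (hE q e he)) }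

/-! ### Additions to the queue -/

theorem State.mem_queue_addEvent {s : State P D} {e e' : Event P D} :
    e' ∈ (s.addEvent e).queue ↔ e' = e ∨ e' ∈ s.queue := by
  simp [State.addEvent]

theorem State.foldl_addEvent {α : Type*} (f : α → Event P D) (l : List α) (s : State P D) :
    (l.foldl (fun t x => t.addEvent (f x)) s).table = s.table ∧
    (l.foldl (fun t x => t.addEvent (f x)) s).dat = s.dat ∧
    ∀ e, e ∈ (l.foldl (fun t x => t.addEvent (f x)) s).queue ↔ e ∈ s.queue ∨ ∃ x ∈ l, e = f x := by
  induction l generalizing s with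
  | nil => simp
  | cons y l ih =>
    obtain ⟨h1, h2, h3⟩ := ih (s.addEvent (f y))
    refine ⟨h1, h2, fun e => ?_⟩
    rw [List.foldl_cons, h3, State.mem_queue_addEvent]
    simp only [List.mem_cons, exists_eq_or_imp]
    tauto

theorem Settled.mono {g : Trace P D} {s t : State P D} {q e} (h : Settled g s q e)
    (htab : t.table = s.table) (hdat : t.dat = s.dat)
    (hn : ∀ b, q.lit.call D e = some b → Event.newcall b ∈ s.queue → Event.newcall b ∈ t.queue)
    (hu : ∀ b, q.lit.call D e = some b → Event.updated b ∈ s.queue → Event.updated b ∈ t.queue) :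
    Settled g t q e := by
  refine ⟨fun b hb => ?_, ?_⟩
  · rw [htab, hdat]
    exact ⟨(h.1 b hb).1, (h.1 b hb).2.imp_right (hn b hb)⟩
  · rw [htab]
    exact h.2.imp_right fun ⟨b, hb, hq⟩ => ⟨b, hb, hu b hb hq⟩

theorem Tied.addNewcall {g : Trace P D} {E s} (h : Tied g E s) {b : AAtom D}
    (hb : s.table b = none) : Tied g E (s.addEvent (.newcall b)) where
  newcall a ha := by
    rcases State.mem_queue_addEvent.1 ha with h0 | h0
    · cases h0; exact hb
    · exact h.newcall a h0
  start_some := h.start_some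
  start_none := h.start_none
  down := h.down
  chain := h.chain
  arcs R hR := h.arcs R <| hR.imp_left fun h0 => by simpa [State.mem_queue_addEvent] using h0
  dat_callee := h.dat_callee
  queue_constraint R hR := h.queue_constraint R <| by
    simpa [State.mem_queue_addEvent] using hR
  progress q e he := (h.progress q e he).imp_right <| Or.imp
    (fun ⟨R, hR, hq⟩ => ⟨R, State.mem_queue_addEvent.2 (Or.inr hR), hq⟩)
    fun hs => hs.mono rfl rfl (fun _ _ hq => State.mem_queue_addEvent.2 (Or.inr hq))
      fun _ _ hq => State.mem_queue_addEvent.2 (Or.inr hq)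

/-- Adding the arc of a point that has just been reached ends the exemption of its position. -/
theorem Tied.addFreshArc {g : Trace P D} {E s} (h : Tied g E s) {R : Arc P D}
    (hR : g.before R.pos = some R.ann) (hR' : g.after R.pos = none) (hu : R.u = 0)
    (hE : ∀ q, E q → q = R.pos) : Tied g (fun _ => False) (s.addEvent (.arc R)) where
  newcall a ha := h.newcall a (by simpa [State.mem_queue_addEvent] using ha)
  start_some := h.start_some
  start_none := h.start_none
  down := h.down
  chain := h.chain
  arcs R' h' := by
    by_cases hRR : R' = R
    · subst hRR
      exact ⟨hR, by simp [hu, hR']⟩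
    · exact h.arcs R' (h'.imp_left fun h0 => by simpa [State.mem_queue_addEvent, hRR] using h0)
  dat_callee := h.dat_callee
  queue_constraint R' h' hc := by
    by_cases hRR : R' = R
    · rw [hRR, hu]
    · exact h.queue_constraint R' (by simpa [State.mem_queue_addEvent, hRR] using h') hc
  progress q e he := by
    right
    rcases h.progress q e he with h0 | ⟨R', h0, hq⟩ | h0
    · exact Or.inl ⟨R, State.mem_queue_addEvent.2 (Or.inl rfl), (hE q h0).symm⟩
    · exact Or.inl ⟨R', State.mem_queue_addEvent.2 (Or.inr h0), hq⟩
    · exact Or.inr (h0.mono rfl rfl (fun _ _ hq => State.mem_queue_addEvent.2 (Or.inr hq))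
        fun _ _ hq => State.mem_queue_addEvent.2 (Or.inr hq))

/-! ### The events `newcall` and `updated` -/

open Classical in
/-- The trace after the event `newcall a`: all the rules for `a` are at their beginning. -/
noncomputable def Trace.begin (g : Trace P D) (a : AAtom D) : Trace P D := fun x =>
  if x.call = a ∧ x.i = 0 then some (D.extend x.rule.head x.call.cp) else g x

theorem Tied.newCallPattern {g : Trace P D} {s : State P D}
    (h : Tied g (fun _ => False) s) {a : AAtom D} (ha : Event.newcall a ∈ s.queue) {t : State P D}
    (htab : t.table = s.table) (hdat : t.dat = s.dat)
    (hq : ∀ e, e ∈ t.queue ↔ e ≠ Event.newcall a ∧ e ∈ s.queue) :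
    Tied (g.begin a) (fun _ => False) (newCallPattern a t) := by
  classical
  have hnone := h.newcall a ha
  -- No rule for `a` has begun.
  have hg : ∀ x : Slot P D, x.call = a → g x = none := fun x hx => by
    by_contra h0
    have h1 := h.isSome_of_reached x h0
    rw [hx, hnone] at h1
    cases h1
  obtain ⟨f1, f2, f3⟩ := State.foldl_addEvent (fun k => Event.arc (firstArc P a k))
    (List.finRange (P a.pred).length) t
  set t' := ACC.newCallPattern a t with ht'
  have htab' : t'.table = Function.update s.table a (some ⊥) := by
    rw [← htab, ← f1]; rfl
  have hdat' : t'.dat = s.dat := by rw [← hdat, ← f2]; rfl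
  have hq' : ∀ e, e ∈ t'.queue ↔
      (e ≠ Event.newcall a ∧ e ∈ s.queue) ∨ ∃ k, e = Event.arc (firstArc P a k) := by
    intro e
    rw [← hq]
    exact (f3 e).trans (by simp)
  clear_value t'
  clear f1 f2 f3
  have hans : t'.table.answer = s.table.answer := by
    funext b
    by_cases hb : b = a
    · subst hb
      simp [Table.answer, htab', hnone]
    · simp [Table.answer, htab', hb]
  have hnext : ∀ x : Slot P D, (g.begin a) x.next = g x.next := fun x =>
    if_neg fun h0 => Nat.succ_ne_zero _ h0.2
  have hafter : ∀ q : ArcPos P D, (g.begin a).after q = g.after q := fun q => hnext q.slot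
  have hold : ∀ x : Slot P D, x.call ≠ a → (g.begin a) x = g x := fun x hx =>
    if_neg fun h0 => hx h0.1
  have hreach : ∀ x : Slot P D, (g.begin a) x = none → g x = none := fun x hx => by
    by_cases hc : x.call = a
    · exact hg x hc
    · rw [← hold x hc, hx]
  have hkeep : ∀ q : ArcPos P D, q.call ≠ a → (g.begin a).before q = g.before q :=
    fun q hc => hold q.slot hc
  have hfirst : ∀ (k : Fin (P a.pred).length),
      (g.begin a).before (firstArc P a k).pos = some (firstArc P a k).ann := fun k => by
    simp [Trace.before, Trace.begin, ArcPos.slot, firstArc, ArcPos.rule]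
  -- A reached point of a rule for `a` is its beginning.
  have hbegin : ∀ (q : ArcPos P D) e, (g.begin a).before q = some e → q.call = a →
      ∃ k, q = (firstArc P a k).pos := by
    rintro ⟨b, k, i⟩ e he hb
    have hb' : b = a := hb
    subst hb'
    have hi : (i : ℕ) = 0 := by
      by_contra hi
      have : (g.begin b).before ⟨b, k, i⟩ = g ⟨b, k, i⟩ :=
        if_neg fun h0 => hi h0.2
      rw [this, hg _ rfl] at he
      simp at he
    exact ⟨k, by simp only [firstArc, ArcPos.mk.injEq, heq_eq_eq, true_and]; exact Fin.ext hi⟩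
  constructor
  · intro b hb
    rcases (hq' _).1 hb with ⟨h1, h2⟩ | ⟨k, h1⟩
    · have hba : b ≠ a := fun h0 => h1 (by rw [h0])
      simpa [htab', hba] using h.newcall b h2
    · cases h1
  · intro b k hb
    by_cases hba : b = a
    · subst hba
      simp [Trace.begin]
    · rw [hold _ hba]
      exact h.start_some b k (by simpa [htab', hba] using hb)
  · intro b k hb
    by_cases hba : b = a
    · subst hba
      simp [htab'] at hb
    · rw [hold _ hba]
      exact h.start_none b k (by simpa [htab', hba] using hb)
  · intro x hx
    rw [hnext]
    exact h.down x (hreach x hx)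
  · intro q e d he hd
    rw [hafter] at hd
    have hc : q.call ≠ a := fun hc => by
      have : g.after q = none := hg q.slot.next hc
      simp [this] at hd
    rw [hkeep q hc] at he
    rw [hans]
    exact h.chain q e d he hd
  · intro R hR
    have : (∃ k, R = firstArc P a k) ∨ (Event.arc R ∈ s.queue ∨ R ∈ s.dat) := by
      rcases hR with hR | hR
      · rcases (hq' _).1 hR with ⟨-, h2⟩ | ⟨k, h1⟩
        · exact Or.inr (Or.inl h2)
        · cases h1
          exact Or.inl ⟨k, rfl⟩
      · rw [hdat'] at hR
        exact Or.inr (Or.inr hR)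
    rcases this with ⟨k, rfl⟩ | hR
    · refine ⟨hfirst k, ?_⟩
      rw [hafter]
      have : g.after (firstArc P a k).pos = none := hg _ rfl
      exact iff_of_true rfl this
    · have h0 := h.arcs R hR
      have hc : R.pos.call ≠ a := fun hc => by
        have : g.before R.pos = none := hg R.pos.slot hc
        simp [this] at h0
      rw [hkeep _ hc, hafter]
      exact h0
  · rw [hdat']
    exact h.dat_callee
  · intro R hR
    rcases (hq' _).1 hR with ⟨-, h2⟩ | ⟨k, h1⟩
    · exact h.queue_constraint R h2
    · cases h1
      exact fun _ => rfl
  · intro q e he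
    right
    by_cases hc : q.call = a
    · obtain ⟨k, hk⟩ := hbegin q e he hc
      exact Or.inl ⟨_, (hq' _).2 (Or.inr ⟨k, rfl⟩), hk.symm⟩
    · rw [hkeep q hc] at he
      rcases h.progress q e he with h0 | ⟨R, h0, hRq⟩ | h0
      · exact h0.elim
      · exact Or.inl ⟨R, (hq' _).2 (Or.inl ⟨by simp, h0⟩), hRq⟩
      · refine Or.inr ⟨fun b hb => ?_, ?_⟩
        · rw [hdat']
          refine ⟨(h0.1 b hb).1, ?_⟩
          by_cases hba : b = a
          · subst hba
            simp [htab']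
          · rw [htab', Function.update_of_ne hba]
            exact (h0.1 b hb).2.imp_right fun h1 => (hq' _).2 (Or.inl ⟨by simp [hba], h1⟩)
        · rw [hans, hafter]
          exact h0.2.imp_right fun ⟨b, hb, h1⟩ => ⟨b, hb, (hq' _).2 (Or.inl ⟨by simp, h1⟩)⟩

theorem Trace.collected_begin (g : Trace P D) (a : AAtom D) :
    (g.begin a).collected = g.collected := by
  funext b
  have : ∀ k : Fin (P b.pred).length, (g.begin a).ruleAns b k = g.ruleAns b k := fun k => by
    have := ((P b.pred).get k).body_ne_nil
    simp only [Trace.ruleAns, Trace.begin, List.length_eq_zero_iff, this, and_false, if_false]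
  simp [Trace.collected, this]

theorem Trace.collected_eq_bot {g : Trace P D} {a : AAtom D}
    (h : ∀ k i, g ⟨a, k, i⟩ = none) : g.collected a = ⊥ := by
  simp [Trace.collected, Trace.ruleAns, h]

/-- The event `updated a` may leave the queue, since every literal that calls `a` has its arc in the
queue or in `DAT`, from where it is put into the queue. -/
theorem Tied.addDependentRules {g : Trace P D} {s : State P D}
    (h : Tied g (fun _ => False) s) {a : AAtom D} {t : State P D}
    (htab : t.table = s.table) (hdat : t.dat = s.dat)
    (hq : ∀ e, e ∈ t.queue ↔ e ≠ Event.updated a ∧ e ∈ s.queue) :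
    Tied g (fun _ => False) (addDependentRules a t) := by
  classical
  obtain ⟨f1, f2, f3⟩ := State.foldl_addEvent (fun R : Arc P D => Event.arc R)
    (t.dat.filter fun R => R.callee = some a) t
  set t' := ACC.addDependentRules a t with ht'
  have htab' : t'.table = s.table := by rw [← htab, ← f1]; rfl
  have hdat' : t'.dat = s.dat := by rw [← hdat, ← f2]; rfl
  have hq' : ∀ e, e ∈ t'.queue ↔ (e ≠ Event.updated a ∧ e ∈ s.queue) ∨
      ∃ R ∈ s.dat, R.callee = some a ∧ e = Event.arc R := by
    intro e
    rw [← hq]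
    exact (f3 e).trans (by simp [hdat, and_assoc])
  clear_value t'
  clear f1 f2 f3
  constructor
  · intro b hb
    rw [htab']
    exact h.newcall b (by simpa using (hq' _).1 hb)
  · rw [htab']; exact h.start_some
  · rw [htab']; exact h.start_none
  · exact h.down
  · rw [htab']; exact h.chain
  · intro R hR
    refine h.arcs R ?_
    rcases hR with hR | hR
    · rcases (hq' _).1 hR with ⟨-, h2⟩ | ⟨R', h1, -, h2⟩
      · exact Or.inl h2
      · cases h2
        exact Or.inr h1
    · rw [hdat'] at hR
      exact Or.inr hR
  · rw [hdat']; exact h.dat_callee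
  · intro R hR hc
    rcases (hq' _).1 hR with ⟨-, h2⟩ | ⟨R', h1, h2, h3⟩
    · exact h.queue_constraint R h2 hc
    · cases h3
      simp [hc] at h2
  · intro q e he
    right
    rcases h.progress q e he with h0 | ⟨R, h0, hRq⟩ | h0
    · exact h0.elim
    · exact Or.inl ⟨R, (hq' _).2 (Or.inl ⟨by simp, h0⟩), hRq⟩
    · by_cases hc : q.lit.call D e = some a
      · obtain ⟨⟨R, hR, rfl⟩, -⟩ := h0.1 a hc
        have he' := (h.arcs R (Or.inr hR)).1
        rw [he] at he'
        cases he'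
        exact Or.inl ⟨R, (hq' _).2 (Or.inr ⟨R, hR, hc, rfl⟩), rfl⟩
      · refine Or.inr (h0.mono htab' hdat' (fun b _ hb => (hq' _).2 (Or.inl ⟨by simp, hb⟩))
          fun b hb hb' => (hq' _).2 (Or.inl ⟨?_, hb'⟩))
        rintro h1
        cases h1
        exact hc hb

/-! ### The traversal of an arc -/

/-- Before the processing of an arc, it is removed from the queue. -/
theorem Tied.removeArc {g : Trace P D} {s t : State P D}
    (h : Tied g (fun _ => False) s) {R : Arc P D}
    (htab : t.table = s.table) (hdat : t.dat = s.dat)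
    (hq : ∀ e, e ∈ t.queue ↔ e ≠ Event.arc R ∧ e ∈ s.queue) :
    Tied g (fun q => q = R.pos) t := by
  constructor
  · intro b hb
    rw [htab]
    exact h.newcall b ((hq _).1 hb).2
  · rw [htab]; exact h.start_some
  · rw [htab]; exact h.start_none
  · exact h.down
  · rw [htab]; exact h.chain
  · intro R' hR'
    rw [hdat, hq] at hR'
    exact h.arcs R' (hR'.imp_left And.right)
  · rw [hdat]; exact h.dat_callee
  · exact fun R' hR' => h.queue_constraint R' ((hq _).1 hR').2
  · intro q e he
    rcases h.progress q e he with h0 | ⟨R', h0, hRq⟩ | h0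
    · exact h0.elim
    · by_cases hRR : R' = R
      · exact Or.inl (by rw [← hRq, hRR])
      · exact Or.inr (Or.inl ⟨R', (hq _).2 ⟨by simp [hRR], h0⟩, hRq⟩)
    · exact Or.inr (Or.inr (h0.mono htab hdat (fun b _ hb => (hq _).2 ⟨by simp, hb⟩)
        fun b _ hb => (hq _).2 ⟨by simp, hb⟩))

/-- The effect on the invariant of the traversal of an arc `R` that was not traversed without
suspension before. The new trace `g'` records the description after the literal, unless it is `⊥`. The
next position is exempt: its arc has yet to be put into the queue. -/
theorem Tied.traverse {g g' : Trace P D} {s t : State P D} {R : Arc P D} {c : ℕ}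
    (h : Tied g (fun q => q = R.pos) s) (htab : t.table = s.table)
    (hq : ∀ e, e ∈ t.queue ↔ e ∈ s.queue ∧ ∀ R', e = .arc R' → R'.pos ≠ R.pos)
    (hdat : ∀ R', R' ∈ t.dat ↔
      (R' ∈ s.dat ∧ R'.pos ≠ R.pos) ∨ (R.callee.isSome ∧ R' = { R with u := c }))
    (hbefore : g.before R.pos = some R.ann) (hafter : g.after R.pos = none)
    (hcallee : ∀ b, R.callee = some b → (s.table b).isSome ∨ Event.newcall b ∈ s.queue)
    (hg : ∀ x, x ≠ R.pos.slot.next → g' x = g x)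
    (hexec : R.pos.lit.exec s.table.answer R.ann = (g'.after R.pos).getD ⊥)
    (hbot : g'.after R.pos ≠ some ⊥) (hc : c = 0 ↔ g'.after R.pos = none) :
    Tied g' (fun q => q.slot = R.pos.slot.next) t := by
  have hkeep : ∀ q : ArcPos P D, q.slot ≠ R.pos.slot.next → g'.before q = g.before q :=
    fun q hq => hg _ hq
  have hkeep' : ∀ q : ArcPos P D, q ≠ R.pos → g'.after q = g.after q :=
    fun q hq => hg _ fun h0 => hq (ArcPos.slot_injective (Slot.next_injective h0))
  have hbeforeR : g'.before R.pos = some R.ann := by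
    rw [hkeep _ (Slot.next_ne_self _).symm, hbefore]
  have hnone : g R.pos.slot.next = none := hafter
  have hstart : ∀ a k, g' ⟨a, k, 0⟩ = g ⟨a, k, 0⟩ := fun a k => hg _ fun h0 => by
    have := congrArg Slot.i h0
    simp [Slot.next] at this
  have hsettled : ∀ q e, q ≠ R.pos → Settled g s q e → Settled g' t q e := by
    intro q e h2 h3
    refine ⟨fun b hb => ?_, ?_⟩
    · obtain ⟨⟨R', hR', hR''⟩, h4⟩ := h3.1 b hb
      refine ⟨⟨R', (hdat R').2 (Or.inl ⟨hR', by rwa [hR'']⟩), hR''⟩, ?_⟩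
      rw [htab, hq]
      exact h4.imp_right fun h5 => ⟨h5, by simp⟩
    · rw [htab, hkeep' q h2]
      exact h3.2.imp_right fun ⟨b, hb, h5⟩ => ⟨b, hb, (hq _).2 ⟨h5, by simp⟩⟩
  constructor
  · intro b hb
    rw [htab]
    exact h.newcall b ((hq _).1 hb).1
  · intro a k
    rw [htab, hstart]
    exact h.start_some a k
  · intro a k
    rw [htab, hstart]
    exact h.start_none a k
  · intro x hx
    by_cases h1 : x = R.pos.slot
    · subst h1
      have : g'.before R.pos = none := hx
      rw [hbeforeR] at this
      cases this
    · rw [hg _ fun h0 => h1 (Slot.next_injective h0)]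
      apply h.down
      by_cases h2 : x = R.pos.slot.next
      · rw [h2, hnone]
      · rw [← hg x h2, hx]
  · intro q e d he hd
    rw [htab]
    by_cases h1 : q = R.pos
    · subst h1
      rw [hbeforeR] at he
      cases he
      rw [hexec, hd]
      exact ⟨fun h0 => hbot (by rw [hd, h0]), le_rfl⟩
    · rw [hkeep' q h1] at hd
      by_cases h2 : q.slot = R.pos.slot.next
      · have : g.after q = none := h.down _ (by rw [h2, hnone])
        rw [this] at hd
        cases hd
      · rw [hkeep q h2] at he
        exact h.chain q e d he hd
  · intro R' hR'
    have : R' = { R with u := c } ∨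
        R'.pos ≠ R.pos ∧ (Event.arc R' ∈ s.queue ∨ R' ∈ s.dat) := by
      rw [hq, hdat] at hR'
      rcases hR' with h1 | h1 | h1
      · exact Or.inr ⟨h1.2 _ rfl, Or.inl h1.1⟩
      · exact Or.inr ⟨h1.2, Or.inr h1.1⟩
      · exact Or.inl h1.2
    rcases this with rfl | ⟨h1, h2⟩
    · exact ⟨hbeforeR, hc⟩
    · obtain ⟨h3, h4⟩ := h.arcs R' h2
      have h5 : R'.pos.slot ≠ R.pos.slot.next := fun h0 => by
        rw [Trace.before_eq_none h0 hnone] at h3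
        cases h3
      rw [hkeep _ h5, hkeep' _ h1]
      exact ⟨h3, h4⟩
  · intro R' hR'
    rcases (hdat R').1 hR' with h1 | ⟨h1, rfl⟩
    · exact h.dat_callee R' h1.1
    · exact h1
  · exact fun R' hR' => h.queue_constraint R' ((hq _).1 hR').1
  · intro q e he
    by_cases h2 : q.slot = R.pos.slot.next
    · exact Or.inl h2
    by_cases h1 : q = R.pos
    · subst h1
      rw [hbeforeR] at he
      cases he
      refine Or.inr (Or.inr ⟨fun b hb => ⟨⟨{ R with u := c }, (hdat _).2 (Or.inr ⟨?_, rfl⟩), rfl⟩, ?_⟩,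
        Or.inl ?_⟩)
      · change R.callee = some b at hb
        simp [hb]
      · rw [htab, hq]
        exact (hcallee b hb).imp_right fun h5 => ⟨h5, by simp⟩
      · rw [htab]
        exact hexec
    · have he' := he
      rw [hkeep q h2] at he'
      rcases h.progress q e he' with h0 | ⟨R', h0, rfl⟩ | h0
      · exact absurd h0 h1
      · exact Or.inr (Or.inl ⟨R', (hq _).2 ⟨h0, by rintro _ ⟨⟩; exact h1⟩, rfl⟩)
      · exact Or.inr (Or.inr (hsettled q e h1 h0))

/-- A call that is in the table, or about to enter it, remains so. -/
def Keeps (s t : State P D) : Prop :=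
  ∀ a, ((s.table a).isSome ∨ Event.newcall a ∈ s.queue) →
    (t.table a).isSome ∨ Event.newcall a ∈ t.queue

theorem getAnswer_fst {n : ℕ} (l : Literal Sg n) (d : D.Desc n) (s : State P D) :
    (getAnswer l d s).1 = l.exec s.table.answer d := by
  cases l with
  | constraint c => rfl
  | atom p f =>
    simp only [getAnswer, lookupAnswer, Literal.exec, Table.answer]
    cases s.table ⟨p, D.restrict f d⟩ <;> rfl

theorem getAnswer_snd {n : ℕ} (l : Literal Sg n) (d : D.Desc n) (s : State P D) :
    ((getAnswer l d s).2 = s ∧ ∀ b, l.call D d = some b → (s.table b).isSome) ∨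
    ∃ b, l.call D d = some b ∧ s.table b = none ∧
      (getAnswer l d s).2 = s.addEvent (.newcall b) := by
  cases l with
  | constraint c => exact Or.inl ⟨rfl, by simp [Literal.call]⟩
  | atom p f =>
    simp only [getAnswer, lookupAnswer, Literal.call, Option.some.injEq, forall_eq']
    cases h : s.table ⟨p, D.restrict f d⟩ with
    | none => exact Or.inr ⟨_, rfl, h, rfl⟩
    | some ap => exact Or.inl ⟨rfl, rfl⟩

/-- A traversal of an arc that issues no error consists of a lookup, a replacement of the arc (for
atoms), and the continuation of the rule unless the arc is suspended. -/
theorem processArc_eq_some {RCert : Table D} {R : Arc P D} {s s' : State P D}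
    (h : processArc RCert R s = some s') :
    ∃ t : State P D,
      ((R.callee = none ∧ t = (getAnswer R.pos.lit R.ann s).2) ∨
        (R.callee.isSome ∧ (getAnswer R.pos.lit R.ann s).1 = ⊥ ∧
          t = (getAnswer R.pos.lit R.ann s).2.addArc R) ∨
        (R.callee.isSome ∧ (getAnswer R.pos.lit R.ann s).1 ≠ ⊥ ∧ R.u = 0 ∧
          t = (getAnswer R.pos.lit R.ann s).2.addArc { R with u := R.u + 1 })) ∧
      (((getAnswer R.pos.lit R.ann s).1 = ⊥ ∧ s' = t) ∨
        ((getAnswer R.pos.lit R.ann s).1 ≠ ⊥ ∧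
          ∃ h : (R.pos.i : ℕ) + 1 < R.pos.rule.body.length,
            s' = t.addEvent (.arc ⟨⟨R.pos.call, R.pos.k, ⟨R.pos.i + 1, h⟩⟩,
              (getAnswer R.pos.lit R.ann s).1, 0⟩)) ∨
        ((getAnswer R.pos.lit R.ann s).1 ≠ ⊥ ∧
          ¬ (R.pos.i : ℕ) + 1 < R.pos.rule.body.length ∧
          insertAnswerInfo RCert R.pos.call
            (D.restrict R.pos.rule.head (getAnswer R.pos.lit R.ann s).1) t = some s')) := by
  unfold processArc at h
  simp only [Option.bind_eq_some_iff] at h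
  obtain ⟨t, ht, h⟩ := h
  refine ⟨t, ?_, ?_⟩
  · clear h
    unfold Arc.callee
    revert ht
    generalize getAnswer R.pos.lit R.ann s = r
    generalize R.pos.lit = l
    intro ht
    cases l with
    | constraint c =>
      simp only [Option.some.injEq] at ht
      exact Or.inl ⟨rfl, ht.symm⟩
    | atom p f =>
      right
      simp only at ht
      split_ifs at ht with h1 h2
      · cases ht
        exact Or.inl ⟨rfl, h1, rfl⟩
      · cases ht
        exact Or.inr ⟨rfl, h1, by omega, rfl⟩
  · split_ifs at h with h1 h2
    · cases h
      exact Or.inl ⟨h1, rfl⟩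
    · cases h
      exact Or.inr (Or.inl ⟨h1, h2, rfl⟩)
    · exact Or.inr (Or.inr ⟨h1, h2, h⟩)

/-! ### The insertion of an answer -/

/-- A larger answer for `a` may unsettle the literals that call `a`; their arcs are in `DAT`, so this
is reported by the event `updated a`. -/
theorem Tied.setAnswer {g : Trace P D} {s t : State P D} (h : Tied g (fun _ => False) s)
    {a : AAtom D} {new : a.Ans} (ha : (s.table a).isSome) (hle : s.table.answer a ≤ new)
    (hself : t.table a = some new) (hother : ∀ b, b ≠ a → t.table b = s.table b)
    (hdat : t.dat = s.dat)
    (hq : ∀ e, e ∈ t.queue ↔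
      e ∈ s.queue ∨ (e = .updated a ∧ ∃ R ∈ s.dat, R.callee = some a)) :
    Tied g (fun _ => False) t := by
  have hsome : ∀ b, (t.table b).isSome = (s.table b).isSome := fun b => by
    by_cases hb : b = a
    · subst hb; simp [hself, ha]
    · rw [hother b hb]
  have hnone : ∀ b, t.table b = none ↔ s.table b = none := fun b => by
    rw [← Option.not_isSome_iff_eq_none, hsome, Option.not_isSome_iff_eq_none]
  have hmono : ∀ b, s.table.answer b ≤ t.table.answer b := fun b => by
    by_cases hb : b = a
    · subst hb; simpa [Table.answer, hself] using hle
    · simp [Table.answer, hother b hb]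
  constructor
  · intro b hb
    rw [hnone]
    exact h.newcall b (by simpa using (hq _).1 hb)
  · intro b k
    rw [hsome]
    exact h.start_some b k
  · intro b k
    rw [hnone]
    exact h.start_none b k
  · exact h.down
  · exact fun q e d he hd => ⟨(h.chain q e d he hd).1,
      (h.chain q e d he hd).2.trans (Literal.exec_mono hmono _ _)⟩
  · intro R hR
    rw [hdat, hq] at hR
    exact h.arcs R (by simpa using hR)
  · rw [hdat]; exact h.dat_callee
  · exact fun R hR => h.queue_constraint R (by simpa using (hq _).1 hR)
  · intro q e he
    rcases h.progress q e he with h0 | ⟨R, h0, hRq⟩ | h0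
    · exact h0.elim
    · exact Or.inr (Or.inl ⟨R, (hq _).2 (Or.inl h0), hRq⟩)
    · refine Or.inr (Or.inr ⟨fun b hb => ?_, ?_⟩)
      · rw [hdat, hsome]
        exact ⟨(h0.1 b hb).1, (h0.1 b hb).2.imp_right fun h1 => (hq _).2 (Or.inl h1)⟩
      · by_cases hc : q.lit.call D e = some a
        · obtain ⟨⟨R, hR, rfl⟩, -⟩ := h0.1 a hc
          have he' := (h.arcs R (Or.inr hR)).1
          rw [he] at he'
          cases he'
          exact Or.inr ⟨a, hc, (hq _).2 (Or.inr ⟨rfl, R, hR, hc⟩)⟩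
        · rw [Literal.exec_congr (T' := s.table.answer) q.lit e fun b hb => ?_]
          · exact h0.2.imp_right fun ⟨b, hb, h1⟩ => ⟨b, hb, (hq _).2 (Or.inl h1)⟩
          · have hba : b ≠ a := by
              rintro rfl
              exact hc hb
            simp [Table.answer, hother b hba]

theorem Tied.insertAnswerInfo {RCert : Table D} {g₀ g : Trace P D} {s s' : State P D}
    (h : Tied g (fun _ => False) s) (hex : Explained RCert g₀ s) {a : AAtom D} {ap : a.Ans}
    (ha : (s.table a).isSome) (hca : g.collected a = ap ⊔ g₀.collected a)
    (hcb : ∀ b, b ≠ a → g.collected b = g₀.collected b)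
    (hs : insertAnswerInfo RCert a ap s = some s') :
    Tied g (fun _ => False) s' ∧ Explained RCert g s' ∧ Keeps s s' := by
  classical
  obtain ⟨ap₀, hap₀⟩ := Option.isSome_iff_exists.1 ha
  obtain ⟨hle, heq⟩ := hex a ap₀ hap₀
  simp only [ACC.insertAnswerInfo, lookupAnswer, hap₀] at hs
  by_cases h1 : ∃ ap' : a.Ans, RCert a = some ap' ∧ ap ⊔ ap' ≠ ap'
  · rw [if_pos h1] at hs
    cases hs
  rw [if_neg h1] at hs
  by_cases h2 : ap₀ = ap ⊔ ap₀
  · -- The new answer does not change the table.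
    rw [if_pos h2] at hs
    cases hs
    refine ⟨h, fun b bp hb => ?_, fun _ => id⟩
    by_cases hba : b = a
    · subst hba
      obtain rfl : ap₀ = bp := Option.some.inj (hap₀.symm.trans hb)
      rw [hca]
      have hap : ap ≤ ap₀ := sup_eq_right.1 h2.symm
      exact ⟨sup_le hap hle, heq.imp_left fun h3 => by rw [h3, ← h2]⟩
    · rw [hcb b hba]
      exact hex b bp hb
  · rw [if_neg h2] at hs
    have hcert : ∀ ap', RCert a = some ap' → ap ≤ ap' := fun ap' h3 => by
      by_contra h4
      exact h1 ⟨ap', h3, fun h5 => h4 (sup_eq_right.1 h5)⟩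
    -- Only an answer of the certificate may exceed the collected answers.
    have hnew : ∀ new : a.Ans, new = (if ap₀ = ⊥ then (RCert a).getD (ap ⊔ ap₀) else ap ⊔ ap₀) →
        ap₀ ≤ new ∧ g.collected a ≤ new ∧ (g.collected a = new ∨ RCert a = some new) := by
      rintro new rfl
      rw [hca]
      split_ifs with h3
      · subst h3
        rw [le_bot_iff.1 hle]
        cases h4 : RCert a with
        | none => simp
        | some ap' => simpa using hcert ap' h4
      · refine ⟨le_sup_right, sup_le_sup_left hle _, Or.inl ?_⟩
        rcases heq with h4 | h4
        · rw [h4]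
        · exact absurd (sup_eq_right.2 (hcert ap₀ h4)).symm h2
    generalize (if ap₀ = ⊥ then (RCert a).getD (ap ⊔ ap₀) else ap ⊔ ap₀) = new at hs hnew
    obtain ⟨hn1, hn2, hn3⟩ := hnew new rfl
    have hans : s.table.answer a = ap₀ := by simp [Table.answer, hap₀]
    have hself : s'.table a = some new := by
      cases hs
      split_ifs <;> simp [State.setAnswer, State.addEvent]
    have hother : ∀ b, b ≠ a → s'.table b = s.table b := fun b hb => by
      cases hs
      split_ifs <;> simp [State.setAnswer, State.addEvent, hb]
    have hdat : s'.dat = s.dat := by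
      cases hs
      split_ifs <;> rfl
    have hq : ∀ e, e ∈ s'.queue ↔
        e ∈ s.queue ∨ (e = .updated a ∧ ∃ R ∈ s.dat, R.callee = some a) := by
      cases hs
      intro e
      split_ifs with h3
      · rw [State.mem_queue_addEvent]
        have h3' : ∃ R ∈ s.dat, R.callee = some a := h3
        simp only [h3', and_true]
        exact or_comm
      · have h3' : ¬ ∃ R ∈ s.dat, R.callee = some a := h3
        simp only [h3', and_false, or_false]
        exact Iff.rfl
    refine ⟨h.setAnswer ha (hans.trans_le hn1) hself hother hdat hq,
      fun b bp hb => ?_, fun b hb => ?_⟩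
    · by_cases hba : b = a
      · subst hba
        have : new = bp := by simpa [hself] using hb
        subst this
        exact ⟨hn2, hn3⟩
      · rw [hcb b hba]
        exact hex b bp ((hother b hba).symm.trans hb)
    · refine hb.imp (fun h3 => ?_) fun h3 => (hq _).2 (Or.inl h3)
      by_cases hba : b = a
      · subst hba; simp [hself]
      · rwa [hother b hba]

/-! ### The main loop -/

/-- The invariant of the main loop. -/
def Invariant (RCert : Table D) (s : State P D) : Prop :=
  ∃ g : Trace P D, Tied g (fun _ => False) s ∧ Explained RCert g s

theorem Trace.collected_congr {g g' : Trace P D} {x : Slot P D} (hg : ∀ y, y ≠ x → g' y = g y)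
    {a : AAtom D} (ha : a = x.call → x.i ≠ ((P x.call.pred).get x.k).body.length) :
    g'.collected a = g.collected a := by
  unfold Trace.collected
  congr 1
  funext k
  unfold Trace.ruleAns
  rw [hg]
  rintro rfl
  exact ha rfl rfl

open Classical in
theorem Trace.collected_update {g : Trace P D} {x : Slot P D} (d : D.Desc x.rule.nvars)
    (hx : x.i = x.rule.body.length) (hnone : g x = none) :
    Trace.collected (Function.update g x (some d)) x.call =
      D.restrict x.rule.head d ⊔ g.collected x.call := by
  obtain ⟨a, k, i⟩ := x
  obtain rfl : i = ((P a.pred).get k).body.length := hx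
  set g' : Trace P D := Function.update g _ (some d) with hg'
  have hk : g'.ruleAns a k = D.restrict ((P a.pred).get k).head d := by
    simp [Trace.ruleAns, hg']
  have hk' : g.ruleAns a k = ⊥ := by
    unfold Trace.ruleAns
    rw [hnone]
    rfl
  have hother : ∀ j, j ≠ k → g'.ruleAns a j = g.ruleAns a j := fun j hj => by
    unfold Trace.ruleAns
    rw [hg', Function.update_of_ne]
    intro h0
    simp only [Slot.mk.injEq, heq_eq_eq, true_and] at h0
    exact hj h0.1
  apply le_antisymm
  · refine Finset.sup_le fun j _ => ?_
    by_cases hj : j = k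
    · rw [hj, hk]
      exact le_sup_left
    · rw [hother j hj]
      exact le_sup_of_le_right (Finset.le_sup (f := fun k => g.ruleAns a k) (Finset.mem_univ j))
  · refine sup_le ?_ (Finset.sup_le fun j _ => ?_)
    · change D.restrict ((P a.pred).get k).head d ≤ _
      rw [← hk]
      exact Finset.le_sup (f := fun k => g'.ruleAns a k) (Finset.mem_univ k)
    · by_cases hj : j = k
      · rw [hj, hk']
        exact bot_le
      · rw [← hother j hj]
        exact Finset.le_sup (f := fun k => g'.ruleAns a k) (Finset.mem_univ j)

theorem Invariant.processArc {RCert : Table D} {s t s' : State P D} {R : Arc P D}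
    (h : Invariant RCert s) (hR : Event.arc R ∈ s.queue)
    (htab : t.table = s.table) (hdat : t.dat = s.dat)
    (hq : ∀ e, e ∈ t.queue ↔ e ≠ Event.arc R ∧ e ∈ s.queue)
    (hs : processArc RCert R t = some s') : Invariant RCert s' ∧ Keeps s s' := by
  classical
  obtain ⟨g, hg, hex⟩ := h
  obtain ⟨hbefore, hu⟩ := hg.arcs R (Or.inl hR)
  obtain ⟨t₂, ht₂, hs'⟩ := processArc_eq_some hs
  have hd : (getAnswer R.pos.lit R.ann t).1 = R.pos.lit.exec s.table.answer R.ann := by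
    rw [getAnswer_fst, htab]
  have hafter : g.after R.pos = none := by
    rcases ht₂ with ⟨h1, -⟩ | ⟨-, h1, -⟩ | ⟨-, -, h1, -⟩
    · exact hu.1 (hg.queue_constraint R hR h1)
    · -- An arc that once was not suspended is not suspended now.
      cases h2 : g.after R.pos with
      | none => rfl
      | some d =>
        obtain ⟨h3, h4⟩ := hg.chain _ _ _ hbefore h2
        rw [← hd, h1] at h4
        exact absurd (le_bot_iff.1 h4) h3
    · exact hu.1 h1
  have hg₀ := hg.removeArc htab hdat hq
  -- The lookup of the answer.
  obtain ⟨hg₁, htab₁, hdat₁, hq₁, hcallee, hkeeps⟩ :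
      Tied g (fun q => q = R.pos) (getAnswer R.pos.lit R.ann t).2 ∧
      (getAnswer R.pos.lit R.ann t).2.table = s.table ∧
      (getAnswer R.pos.lit R.ann t).2.dat = s.dat ∧
      (∀ R', Event.arc R' ∈ (getAnswer R.pos.lit R.ann t).2.queue →
        R' ≠ R ∧ Event.arc R' ∈ s.queue) ∧
      (∀ b, R.callee = some b →
        ((getAnswer R.pos.lit R.ann t).2.table b).isSome ∨
          Event.newcall b ∈ (getAnswer R.pos.lit R.ann t).2.queue) ∧
      Keeps s (getAnswer R.pos.lit R.ann t).2 := by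
    rcases getAnswer_snd R.pos.lit R.ann t with ⟨h1, h2⟩ | ⟨b, h1, h2, h3⟩
    · rw [h1]
      refine ⟨hg₀, htab, hdat, fun R' h3 => ?_, fun b hb => Or.inl (h2 b hb), fun b hb => ?_⟩
      · simpa using (hq _).1 h3
      · rw [htab, hq]
        simpa using hb
    · rw [h3]
      refine ⟨hg₀.addNewcall h2, htab, hdat, fun R' h3 => ?_, fun c hc => Or.inr ?_, fun c hc => ?_⟩
      · simpa [State.mem_queue_addEvent, hq] using h3
      · have : some c = some b := hc.symm.trans h1
        cases this
        exact State.mem_queue_addEvent.2 (Or.inl rfl)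
      · rw [State.mem_queue_addEvent, hq]
        change (t.table c).isSome ∨ _
        rw [htab]
        exact hc.imp_right fun h4 => Or.inr ⟨by simp, h4⟩
  rw [hd] at hs' ht₂
  clear hd hs
  generalize (getAnswer R.pos.lit R.ann t).2 = t₁ at *
  generalize hdd : R.pos.lit.exec s.table.answer R.ann = d at *
  -- The replacement of the arc.
  obtain ⟨c, htab₂, hc, hq₂, hdat₂⟩ : ∃ c, t₂.table = t₁.table ∧ (c = 0 ↔ d = ⊥) ∧
      (∀ e, e ∈ t₂.queue ↔ e ∈ t₁.queue ∧ ∀ R', e = .arc R' → R'.pos ≠ R.pos) ∧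
      ∀ R', R' ∈ t₂.dat ↔
        (R' ∈ t₁.dat ∧ R'.pos ≠ R.pos) ∨ (R.callee.isSome ∧ R' = { R with u := c }) := by
    have hadd : ∀ R₁ : Arc P D, R₁.pos = R.pos → R.callee.isSome → t₂ = t₁.addArc R₁ →
        t₂.table = t₁.table ∧
        (∀ e, e ∈ t₂.queue ↔ e ∈ t₁.queue ∧ ∀ R', e = .arc R' → R'.pos ≠ R.pos) ∧
        ∀ R', R' ∈ t₂.dat ↔ (R' ∈ t₁.dat ∧ R'.pos ≠ R.pos) ∨ (R.callee.isSome ∧ R' = R₁) := by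
      rintro R₁ h1 h2 rfl
      refine ⟨rfl, fun e => ?_, fun R' => ?_⟩
      · simp [State.addArc, h1]
      · simp [State.addArc, h1, h2, or_comm]
    rcases ht₂ with ⟨h1, rfl⟩ | ⟨h1, h2, h3⟩ | ⟨h1, h2, h3, h4⟩
    · refine ⟨if d = ⊥ then 0 else 1, rfl, by simp, fun e => ?_, fun R' => ?_⟩
      · refine ⟨fun he => ⟨he, ?_⟩, And.left⟩
        rintro R' rfl h2
        obtain ⟨h3, h4⟩ := hq₁ R' he
        obtain ⟨h5, h6⟩ := hg.arcs R' (Or.inl h4)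
        obtain ⟨p, e, u⟩ := R
        obtain ⟨p', e', u'⟩ := R'
        obtain rfl : p' = p := h2
        simp only at hbefore h5 hafter hu h6
        obtain rfl : u = 0 := hu.2 hafter
        obtain rfl : u' = 0 := h6.2 hafter
        rw [hbefore] at h5
        cases h5
        exact h3 rfl
      · simp only [h1, Option.isSome_none, Bool.false_eq_true, false_and, or_false]
        refine ⟨fun he => ⟨he, fun h2 => ?_⟩, And.left⟩
        rw [hdat₁] at he
        have h3 := hg.dat_callee R' he
        have h5 := (hg.arcs R' (Or.inr he)).1
        obtain ⟨p, e, u⟩ := R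
        obtain ⟨p', e', u'⟩ := R'
        obtain rfl : p' = p := h2
        simp only at hbefore h5
        rw [hbefore] at h5
        cases h5
        change p'.lit.call D _ = none at h1
        change (p'.lit.call D _).isSome = true at h3
        rw [h1] at h3
        cases h3
    · obtain ⟨h4, h5, h6⟩ := hadd R rfl h1 h3
      obtain rfl : d = ⊥ := h2
      have hu0 : R.u = 0 := hu.2 hafter
      exact ⟨R.u, h4, by simp [hu0], h5, h6⟩
    · obtain ⟨h5, h6, h7⟩ := hadd { R with u := R.u + 1 } rfl h1 h4
      exact ⟨R.u + 1, h5, by simp [h2], h6, h7⟩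
  have hkeeps₂ : Keeps s t₂ := fun b hb => by
    rw [htab₂, hq₂]
    exact (hkeeps b hb).imp_right fun h1 => ⟨h1, by simp⟩
  have hex₂ : Explained RCert g t₂ := by
    unfold Explained
    rw [htab₂, htab₁]
    exact hex
  have hexec : R.pos.lit.exec t₁.table.answer R.ann = d := by rw [htab₁, hdd]
  rcases hs' with ⟨rfl, rfl⟩ | hs'
  · -- The arc is suspended.
    have h1 := hg₁.traverse (g' := g) htab₂ hq₂ hdat₂ hbefore hafter hcallee (fun _ _ => rfl)
      (by rw [hexec, hafter]; rfl) (by rw [hafter]; simp) (by simp [hc, hafter])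
    refine ⟨⟨g, h1.drop_exempt fun q e he h2 => ?_, hex₂⟩, hkeeps₂⟩
    rw [Trace.before_eq_none h2 hafter] at he
    cases he
  · have hbot : d ≠ ⊥ := hs'.elim And.left And.left
    set g' : Trace P D := Function.update g R.pos.slot.next (some d) with hg'
    have hne : ∀ x, x ≠ R.pos.slot.next → g' x = g x := fun x hx => Function.update_of_ne hx _ _
    have hafter' : g'.after R.pos = some d :=
      Function.update_self (β := fun x : Slot P D => Option (D.Desc x.rule.nvars))
        R.pos.slot.next (some d) g
    have h1 := hg₁.traverse (g' := g') htab₂ hq₂ hdat₂ hbefore hafter hcallee hne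
      (by rw [hexec, hafter']; rfl) (by rw [hafter']; simpa using hbot) (by simp [hc, hafter', hbot])
    rcases hs' with ⟨-, hlt, rfl⟩ | ⟨-, hlt, hs'⟩
    · -- The arc of the next literal is put into the queue.
      set R₁ : Arc P D := ⟨⟨R.pos.call, R.pos.k, ⟨R.pos.i + 1, hlt⟩⟩, d, 0⟩ with hR₁
      have hslot : R₁.pos.slot = R.pos.slot.next := rfl
      refine ⟨⟨g', h1.addFreshArc (R := R₁) hafter' ?_ rfl fun q h2 =>
        ArcPos.slot_injective (h2.trans hslot.symm), ?_⟩, fun b hb => (hkeeps₂ b hb).imp_right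
          fun h2 => State.mem_queue_addEvent.2 (Or.inr h2)⟩
      · exact (hne _ (Slot.next_ne_self _)).trans (hg.down _ hafter)
      · intro b bp hb
        rw [Trace.collected_congr hne fun _ => hlt.ne]
        exact hex₂ b bp hb
    · -- The rule is complete.
      have hlen : R.pos.slot.next.i = R.pos.slot.next.rule.body.length :=
        le_antisymm R.pos.i.2 (not_lt.1 hlt)
      have h2 : Tied g' (fun _ => False) t₂ := h1.drop_exempt fun q e _ h3 => by
        have h4 : q.slot.i < q.slot.rule.body.length := q.i.2
        rw [h3, hlen] at h4
        exact h4.false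
      have hsome : (t₂.table R.pos.call).isSome := by
        rw [htab₂, htab₁]
        refine hg.isSome_of_reached R.pos.slot fun h3 => ?_
        have h4 : g.before R.pos = none := h3
        rw [h4] at hbefore
        cases hbefore
      obtain ⟨h3, h4, h5⟩ := h2.insertAnswerInfo hex₂ hsome
        (Trace.collected_update d hlen hafter)
        (fun b hb => Trace.collected_congr hne fun h3 => absurd h3 hb) hs'
      exact ⟨⟨g', h3, h4⟩, fun b hb => h5 b (hkeeps₂ b hb)⟩

theorem Invariant.step {Ω : QHS (Event P D)} {RCert : Table D} {s s' : State P D}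
    (h : Invariant RCert s) (hs : step Ω RCert s = some s') :
    Invariant RCert s' ∧ Keeps s s' := by
  classical
  unfold ACC.step at hs
  split_ifs at hs with hQ
  · have he := Ω.select_mem s.added s.queue hQ
    generalize Ω.select s.added s.queue hQ = e at hs he
    have hq : ∀ e', e' ∈ ({ s with queue := s.queue.erase e } : State P D).queue ↔
        e' ≠ e ∧ e' ∈ s.queue := fun e' => Finset.mem_erase
    cases e with
    | newcall a =>
      obtain ⟨g, hg, hex⟩ := h
      simp only [Option.some.injEq] at hs
      have htied := hg.newCallPattern he (t := { s with queue := s.queue.erase (.newcall a) })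
        rfl rfl (by simp)
      have hnone := hg.newcall a he
      obtain ⟨f1, -, f3⟩ := State.foldl_addEvent (fun k => Event.arc (firstArc P a k))
        (List.finRange (P a.pred).length) { s with queue := s.queue.erase (.newcall a) }
      have hself : s'.table a = some ⊥ := by
        rw [← hs]
        simp [newCallPattern, State.setAnswer]
      have hother : ∀ b, b ≠ a → s'.table b = s.table b := fun b hb => by
        rw [← hs]
        simp only [newCallPattern, State.setAnswer, Function.update_of_ne hb]
        exact congrFun f1 b
      have hcol : g.collected a = ⊥ := Trace.collected_eq_bot fun k i => by
        by_contra h0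
        have h1 := hg.isSome_of_reached _ h0
        rw [hnone] at h1
        cases h1
      refine ⟨⟨g.begin a, ?_, fun b bp hb => ?_⟩, fun b hb => ?_⟩
      · rw [← hs]
        convert htied
      · rw [Trace.collected_begin]
        by_cases hba : b = a
        · subst hba
          rw [hself] at hb
          cases hb
          simp [hcol]
        · exact hex b bp ((hother b hba).symm.trans hb)
      · by_cases hba : b = a
        · subst hba
          simp [hself]
        · rw [hother b hba]
          refine hb.imp_right fun h1 => ?_
          rw [← hs]
          exact (f3 _).2 (Or.inl ((hq _).2 ⟨by simp [hba], h1⟩))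
    | updated a =>
      obtain ⟨g, hg, hex⟩ := h
      simp only [Option.some.injEq] at hs
      have htied := hg.addDependentRules (a := a)
        (t := { s with queue := s.queue.erase (.updated a) }) rfl rfl (by simp)
      obtain ⟨f1, -, f3⟩ := State.foldl_addEvent (fun R : Arc P D => Event.arc R)
        (s.dat.filter fun R => R.callee = some a) { s with queue := s.queue.erase (.updated a) }
      have htab : s'.table = s.table := by
        rw [← hs]
        exact f1
      refine ⟨⟨g, ?_, ?_⟩, fun b hb => ?_⟩
      · rw [← hs]
        convert htied
      · unfold Explained
        rw [htab]
        exact hex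
      · rw [htab]
        refine hb.imp_right fun h1 => ?_
        rw [← hs]
        exact (f3 _).2 (Or.inl ((hq _).2 ⟨by simp, h1⟩))
    | arc R => exact h.processArc (t := { s with queue := s.queue.erase (.arc R) }) he rfl rfl hq hs
  · cases hs
    exact ⟨h, fun _ => id⟩

theorem invariant_initState (S : Finset (AAtom D)) (RCert : Table D) :
    Invariant RCert (initState P S) ∧
      ∀ a ∈ S, Event.newcall a ∈ (initState P S).queue := by
  obtain ⟨f1, f2, f3⟩ := State.foldl_addEvent (P := P) (D := D) (fun a => Event.newcall a)
    S.toList ⟨fun _ => none, [], ∅, []⟩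
  change (initState P S).table = _ at f1
  change (initState P S).dat = _ at f2
  change ∀ e, e ∈ (initState P S).queue ↔ _ at f3
  generalize initState P S = s at *
  simp only [Finset.notMem_empty, Finset.mem_toList, false_or] at f1 f2 f3
  refine ⟨⟨fun _ => none, ?_, ?_⟩, fun a ha => (f3 _).2 ⟨a, ha, rfl⟩⟩
  · constructor <;> simp [f1, f2, f3, Trace.before]
  · intro a ap h
    simp [f1] at h

theorem invariant_run {S : Finset (AAtom D)} {Ω : QHS (Event P D)} {RCert : Table D} {n : ℕ}
    {s : State P D} (hs : run P S Ω RCert n = some s) :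
    Invariant RCert s ∧ ∀ a ∈ S, (s.table a).isSome ∨ Event.newcall a ∈ s.queue := by
  induction n generalizing s with
  | zero =>
    cases hs
    obtain ⟨h1, h2⟩ := invariant_initState (P := P) S RCert
    exact ⟨h1, fun a ha => Or.inr (h2 a ha)⟩
  | succ n ih =>
    obtain ⟨t, ht, hs⟩ := Option.bind_eq_some_iff.1 hs
    obtain ⟨h1, h2⟩ := ih ht
    obtain ⟨h3, h4⟩ := h1.step hs
    exact ⟨h3, fun a ha => h4 a (h2 a ha)⟩

/-! ### Final states -/

/-- In a final state the trace is the execution of the rules with the final table. -/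
theorem Tied.execBody_drop {g : Trace P D} {s : State P D} (h : Tied g (fun _ => False) s)
    (hQ : s.queue = ∅) (a : AAtom D) (k : Fin (P a.pred).length) (m i : ℕ)
    (hi : i + m = ((P a.pred).get k).body.length) (e : D.Desc ((P a.pred).get k).nvars)
    (he : g ⟨a, k, i⟩ = some e) :
    execBody s.table.answer (((P a.pred).get k).body.drop i) e =
      (g ⟨a, k, ((P a.pred).get k).body.length⟩).getD ⊥ ∧
    ∀ b ∈ bodyCalls s.table.answer (((P a.pred).get k).body.drop i) e, (s.table b).isSome := by
  induction m generalizing i e with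
  | zero =>
    obtain rfl : i = _ := hi
    rw [List.drop_length, he]
    exact ⟨rfl, fun b hb => hb.elim⟩
  | succ m ih =>
    have hlt : i < ((P a.pred).get k).body.length := by omega
    set q : ArcPos P D := ⟨a, k, ⟨i, hlt⟩⟩ with hqdef
    have hbefore : g.before q = some e := he
    obtain ⟨hcall, hexec⟩ : Settled g s q e :=
      ((h.progress q e hbefore).resolve_left id).resolve_left (by simp [hQ])
    replace hexec := hexec.resolve_right (by simp [hQ])
    have hcall' : ∀ b, ((P a.pred).get k).body[i].call D e = some b →
        (s.table b).isSome := fun b hb => (hcall b hb).2.resolve_right (by simp [hQ])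
    rw [List.drop_eq_getElem_cons hlt]
    unfold execBody bodyCalls
    change ((P a.pred).get k).body[i].exec s.table.answer e = (g ⟨a, k, i + 1⟩).getD ⊥ at hexec
    rw [hexec]
    cases hd : g ⟨a, k, i + 1⟩ with
    | none =>
      -- No later point is reached.
      have hend : ∀ j, g ⟨a, k, i + 1 + j⟩ = none := fun j => by
        induction j with
        | zero => exact hd
        | succ j ihj => exact h.down ⟨a, k, i + 1 + j⟩ ihj
      have hlen : g ⟨a, k, ((P a.pred).get k).body.length⟩ = none := by
        have := hend m
        rwa [show i + 1 + m = ((P a.pred).get k).body.length by omega] at this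
      rw [hlen]
      refine ⟨by simp, fun b hb => ?_⟩
      rcases hb with hb | hb
      · exact hcall' b hb
      · exact absurd rfl hb.1
    | some d =>
      have hbot : d ≠ ⊥ := (h.chain q e d hbefore hd).1
      obtain ⟨h1, h2⟩ := ih (i + 1) (by omega) d hd
      refine ⟨by simpa [hbot] using h1, fun b hb => ?_⟩
      rcases hb with hb | hb
      · exact hcall' b hb
      · exact h2 b hb.2

theorem Tied.progAns_eq_collected {g : Trace P D} {s : State P D}
    (h : Tied g (fun _ => False) s) (hQ : s.queue = ∅) {a : AAtom D} (ha : (s.table a).isSome) :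
    progAns P s.table.answer a = g.collected a := by
  unfold progAns Trace.collected
  congr 1
  funext k
  have hbody := (h.execBody_drop hQ a k _ 0 (Nat.zero_add _) _ (h.start_some a k ha)).1
  rw [List.drop_zero] at hbody
  unfold Rule.ans Trace.ruleAns
  rw [hbody]
  cases hd : g ⟨a, k, ((P a.pred).get k).body.length⟩ with
  | none => simp
  | some d =>
    have hpos := List.length_pos_of_ne_nil ((P a.pred).get k).body_ne_nil
    obtain ⟨j, hj⟩ := Nat.exists_eq_succ_of_ne_zero hpos.ne'
    have hbot : d ≠ ⊥ := by
      have hafter : g.after ⟨a, k, ⟨j, by omega⟩⟩ = some d := by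
        rw [hj] at hd
        exact hd
      cases hb : g.before ⟨a, k, ⟨j, by omega⟩⟩ with
      | none =>
        have := h.down _ hb
        have h3 := hafter.symm.trans this
        cases h3
      | some e => exact (h.chain _ e d hb hafter).1
    simp [hbot]

theorem Tied.isSome_of_mem_progCalls {g : Trace P D} {s : State P D}
    (h : Tied g (fun _ => False) s) (hQ : s.queue = ∅) {a b : AAtom D} (ha : (s.table a).isSome)
    (hb : b ∈ progCalls P s.table.answer a) : (s.table b).isSome := by
  obtain ⟨k, hk⟩ := hb
  exact (h.execBody_drop hQ a k _ 0 (Nat.zero_add _) _ (h.start_some a k ha)).2 b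
    (by rwa [List.drop_zero])

/-- The table of a final state is a fixpoint, with exact answers outside the certificate. -/
theorem Terminates.isFixpoint {S : Finset (AAtom D)} {Ω : QHS (Event P D)} {RCert : Table D}
    {s : State P D} (hs : Terminates P S Ω RCert s) :
    IsFixpoint P S s.table ∧ ∀ (a : AAtom D) (ap : a.Ans), s.table a = some ap →
      progAns P s.table.answer a = ap ∨ RCert a = some ap := by
  obtain ⟨n, hn, hQ⟩ := hs
  obtain ⟨⟨g, hg, hex⟩, hS⟩ := invariant_run hn
  refine ⟨?_, fun a ap ha => ?_⟩
  · funext a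
    unfold analysisOp
    cases ha : s.table a with
    | none =>
      refine if_neg ?_
      have hnone : ¬ (s.table a).isSome := by simp [ha]
      rintro (h1 | h1 | ⟨b, h1, h2⟩)
      · exact hnone ((hS a h1).resolve_right (by simp [hQ]))
      · cases h1
      · exact hnone (hg.isSome_of_mem_progCalls hQ h1 h2)
    | some ap =>
      refine (if_pos (Or.inr (Or.inl rfl))).trans ?_
      rw [hg.progAns_eq_collected hQ (by simp [ha])]
      have : s.table.answer a = ap := by simp [Table.answer, ha]
      rw [this, sup_eq_left.2 (hex a ap ha).1]
  · rw [hg.progAns_eq_collected hQ (by simp [ha])]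
    exact (hex a ap ha).2

end Correctness

end ACC

theorem mainTheorem1 {Sg : ACC.Signature.{u, v}} (P : ACC.Program Sg)
    (D : ACC.AbsDomain.{u, v, w} Sg) (S : Finset (ACC.AAtom D)) (I : ACC.Table D)
    (Ω : ACC.QHS (ACC.Event P D)) (RCert FCert : ACC.Table D)
    (hChecker : ACC.checker P D S I Ω RCert = some FCert) :
    (ACC.IsFixpoint P S FCert ∧
      ∀ (a : ACC.AAtom D) (ap : a.Ans), FCert a = some ap →
        ACC.progAns P FCert.answer a = ap ∨ RCert a = some ap) ∧
    FCert.Below I := by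
  unfold ACC.checker at hChecker
  cases hc : ACC.checking P S Ω RCert with
  | none =>
    rw [hc] at hChecker
    cases hChecker
  | some F =>
    rw [hc] at hChecker
    simp only at hChecker
    split_ifs at hChecker with hB
    cases hChecker
    unfold ACC.checking at hc
    split_ifs at hc with ht
    cases hc
    exact ⟨ht.choose_spec.isFixpoint, hB⟩
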